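/- Let $\mathcal M$ be a von Neumann algebra acting on a complex Hilbert space, with predual $\mathcal M_*$ and positive cone $\mathcal M_+$, and let $\phi$ be a faithful normal state on $\mathcal M$ with GNS triple $(\mathcal H_\phi,\pi_\phi,\zeta_\phi)$; write $x\zeta_\phi$ for $\pi_\phi(x)\zeta_\phi$. Let $P^{1/2}_\phi(\mathcal M)$ be the set of positive linear maps $\tau:\mathcal M\to\mathcal M$ such that $\phi(\tau(x))\le\phi(x)$ for all $x\in\mathcal M_+$, $\tau(1)\le 1$, and $\phi(\tau(x^*)\tau(x))\le\phi(x^*x)$ for all $x\in\mathcal M$. For $\tau\in P^{1/2}_\phi(\mathcal M)$ let $T$ be the contraction of $\mathcal H_\phi$ with $Tx\zeta_\phi=\tau(x)\zeta_\phi$ for $x\in\mathcal M$, let $P$ be the orthogonal projection onto $\{f\in\mathcal H_\phi:Tf=f\}$, let $\mathcal N=\{x\in\mathcal M:\tau(x)=x\}$, and put $s_n=\frac1n\sum_{k=0}^{n-1}\tau^k$ for $n\ge1$. **Theorem 2.3.** Let $\tau\in P^{1/2}_\phi(\mathcal M)$. Then $s_n\in P^{1/2}_\phi(\mathcal M)$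 for every $n\ge1$, and there is a positive linear map $E\in P^{1/2}_\phi(\mathcal M)$ with range equal to $\mathcal N$ such that, for every $\psi\in\mathcal M_*$, the functionals $\psi\circ s_n$ and $\psi\circ E$ belong to $\mathcal M_*$ and $\|\psi\circ s_n-\psi\circ E\|\to0$ as $n\to\infty$. Further: (a) $Px\zeta_\phi=E(x)\zeta_\phi$ for all $x\in\mathcal M$, and the range $\{f:Tf=f\}$ of $P$ is the closed linear span of $\{x\zeta_\phi:x\in\mathcal N\}$. (b) $\mathcal N$ is a von Neumann algebra (containing the identity of $\mathcal M$) if and only if $E(1)=1$ and $yE(x)z=E(yxz)$ for all $y,z\in\mathcal N$ and $x\in\mathcal M$. Moreover $E(1)=1$ if and only if $\tau(1)=1$. -/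

import Mathlib

open Filter Topology
open scoped ComplexOrder InnerProductSpace

namespace VNErgodic

universe u

variable {K : Type u} [NormedAddCommGroup K] [InnerProductSpace ℂ K] [CompleteSpace K]

/-! ### A von Neumann algebra as an ordered C⋆-algebra

`M` is a von Neumann algebra on `K`. Its algebraic operations, star, norm and order (the usual
order of operators) are those inherited from `K →L[ℂ] K`. -/

instance instSMulMemClassVN : SMulMemClass (VonNeumannAlgebra K) ℂ (K →L[ℂ] K) where
  smul_mem {s} c _ hx := s.toStarSubalgebra.smul_mem hx c

instance instIsClosedVN (M : VonNeumannAlgebra K) : IsClosed (M : Set (K →L[ℂ] K)) := by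
  rw [← M.centralizer_centralizer]
  exact Set.isClosed_centralizer _

noncomputable instance instCStarAlgebraVN (M : VonNeumannAlgebra K) : CStarAlgebra M :=
  StarSubalgebra.cstarAlgebra M

theorem sqrt_mem_vn (M : VonNeumannAlgebra K) {x : K →L[ℂ] K} (hx : x ∈ M) :
    CFC.sqrt x ∈ M := by
  have h : CFC.sqrt x ∈ Set.centralizer (Set.centralizer (M : Set (K →L[ℂ] K))) := by
    intro y hy
    have hc : Commute x y := hy x hx
    exact ((hc.cfcₙ_nnreal NNReal.sqrt).symm).eq
  rwa [M.centralizer_centralizer] at h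

instance instStarOrderedRingVN (M : VonNeumannAlgebra K) : StarOrderedRing M :=
  StarOrderedRing.of_nonneg_iff'
    (fun {x y} hxy z => by
      have h : (x : K →L[ℂ] K) ≤ y := hxy
      change (z : K →L[ℂ] K) + x ≤ z + y
      gcongr)
    (fun x => by
      constructor
      · intro hx
        have hx' : (0 : K →L[ℂ] K) ≤ x := hx
        refine ⟨⟨CFC.sqrt (x : K →L[ℂ] K), sqrt_mem_vn M x.2⟩, Subtype.ext ?_⟩
        have hs : star (CFC.sqrt (x : K →L[ℂ] K)) = CFC.sqrt (x : K →L[ℂ] K) :=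
          (IsSelfAdjoint.of_nonneg (CFC.sqrt_nonneg _)).star_eq
        change (x : K →L[ℂ] K) = star (CFC.sqrt (x : K →L[ℂ] K)) * CFC.sqrt (x : K →L[ℂ] K)
        rw [hs, CFC.sqrt_mul_sqrt_self _ hx']
      · rintro ⟨s, rfl⟩
        change (0 : K →L[ℂ] K) ≤ star (s : K →L[ℂ] K) * s
        exact star_mul_self_nonneg _)

/-! ### The predual and normal states -/

/-- The vector functional `x ↦ ⟪f, x g⟫` on `M`. -/
noncomputable def vectorFunctional (M : VonNeumannAlgebra K) (f g : K) : M →L[ℂ] ℂ :=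
  LinearMap.mkContinuous
    { toFun := fun x => ⟪f, (x : K →L[ℂ] K) g⟫_ℂ
      map_add' := fun x y => by
        change ⟪f, ((x : K →L[ℂ] K) + (y : K →L[ℂ] K)) g⟫_ℂ = _
        rw [add_apply, inner_add_right]
      map_smul' := fun c x => by
        change ⟪f, (c • (x : K →L[ℂ] K)) g⟫_ℂ = _
        rw [smul_apply, inner_smul_right]
        rfl }
    (‖f‖ * ‖g‖)
    (fun x => by
      calc ‖⟪f, (x : K →L[ℂ] K) g⟫_ℂ‖ ≤ ‖f‖ * ‖(x : K →L[ℂ] K) g‖ := norm_inner_le_norm _ _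
        _ ≤ ‖f‖ * (‖(x : K →L[ℂ] K)‖ * ‖g‖) := by
            gcongr
            exact (x : K →L[ℂ] K).le_opNorm g
        _ = ‖f‖ * ‖g‖ * ‖x‖ := by
            change _ = ‖f‖ * ‖g‖ * ‖(x : K →L[ℂ] K)‖
            ring)

/-- A positive linear map between C⋆-algebras as a bounded linear map (positive maps are
automatically bounded). -/
noncomputable def toCLM {A B : Type*} [CStarAlgebra A] [PartialOrder A] [StarOrderedRing A]
    [CStarAlgebra B] [PartialOrder B] [StarOrderedRing B] (f : A →ₚ[ℂ] B) : A →L[ℂ] B where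
  toLinearMap := f.toLinearMap
  cont := map_continuous f

/-- The predual `M_*`: the norm-closed subspace of the Banach dual of `M` spanned by the vector
functionals. These are exactly the `σ`-weakly continuous functionals on `M`; the norm of `M_*` is
that of the Banach dual. -/
noncomputable def predual (M : VonNeumannAlgebra K) : Submodule ℂ (M →L[ℂ] ℂ) :=
  (Submodule.span ℂ {ψ | ∃ f g : K, ψ = vectorFunctional M f g}).topologicalClosure

/-- A positive functional `φ` on `M` (automatically bounded) is a faithful normal state. -/
structure IsFaithfulNormalState {M : VonNeumannAlgebra K} (φ : M →ₚ[ℂ] ℂ) : Prop where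
  map_one : φ 1 = 1
  normal : toCLM φ ∈ predual M
  faithful : ∀ x : M, 0 ≤ x → φ x = 0 → x = 0

/-! ### The class `P^{1/2}_φ(M)` and the averages -/

/-- The set `P^{1/2}_φ(M)` of positive linear maps `τ` on `M` with `φ ∘ τ ≤ φ` on `M₊`,
`τ(1) ≤ 1` and `φ(τ(x*)τ(x)) ≤ φ(x*x)`. -/
def PHalf {M : VonNeumannAlgebra K} (φ : M →ₚ[ℂ] ℂ) : Set (M →ₚ[ℂ] M) :=
  {τ | (∀ x : M, 0 ≤ x → φ (τ x) ≤ φ x) ∧ τ 1 ≤ 1 ∧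
    ∀ x : M, φ (τ (star x) * τ x) ≤ φ (star x * x)}

theorem cesaro_nonneg {M : VonNeumannAlgebra K} (τ : M →ₚ[ℂ] M) (n : ℕ) (x : M) (hx : 0 ≤ x) :
    0 ≤ ((n : ℂ)⁻¹ • ∑ k ∈ Finset.range n, τ.toLinearMap ^ k) x := by
  have hpow : ∀ k : ℕ, 0 ≤ (τ.toLinearMap ^ k) x := by
    intro k
    induction k with
    | zero => simpa using hx
    | succ k ih =>
      rw [pow_succ', Module.End.mul_apply]
      exact τ.map_nonneg ih
  have hsum : 0 ≤ ∑ k ∈ Finset.range n, (τ.toLinearMap ^ k) x :=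
    Finset.sum_nonneg fun k _ => hpow k
  rw [LinearMap.smul_apply, LinearMap.sum_apply]
  have hn : ((n : ℂ)⁻¹) = (((n : ℝ)⁻¹ : ℝ) : ℂ) := by push_cast; rfl
  rw [hn, Complex.coe_smul]
  exact smul_nonneg (by positivity) hsum

/-- The Cesàro average `s_n = (1/n) ∑_{k < n} τ^k`. -/
noncomputable def cesaro {M : VonNeumannAlgebra K} (τ : M →ₚ[ℂ] M) (n : ℕ) : M →ₚ[ℂ] M :=
  PositiveLinearMap.mk₀ ((n : ℂ)⁻¹ • ∑ k ∈ Finset.range n, τ.toLinearMap ^ k)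
    (cesaro_nonneg τ n)

/-- The fixed-point space `N = {x ∈ M : τ(x) = x}`. -/
def fixedPoints {M : VonNeumannAlgebra K} (τ : M →ₚ[ℂ] M) : Set M :=
  {x | τ x = x}

/-- A subset of `M` is a von Neumann algebra (on `K`, hence containing the identity operator). -/
def IsVonNeumannSubalgebra {M : VonNeumannAlgebra K} (N : Set M) : Prop :=
  ∃ S : VonNeumannAlgebra K, (S : Set (K →L[ℂ] K)) = Subtype.val '' N

/-! ### The GNS space of `φ` and the contraction induced by `τ` -/

/-- The cyclic vector `ζ_φ` of the GNS space of `φ`, the class of `1`. -/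
noncomputable def gnsVector {M : VonNeumannAlgebra K} (φ : M →ₚ[ℂ] ℂ) : φ.GNS :=
  ((φ.toPreGNS 1 : φ.PreGNS) : φ.GNS)

/-- The vector `π_φ(x) ζ_φ` of the GNS space of `φ`. -/
noncomputable def gnsEmbed {M : VonNeumannAlgebra K} (φ : M →ₚ[ℂ] ℂ) (x : M) : φ.GNS :=
  φ.gnsStarAlgHom x (gnsVector φ)

theorem gnsEmbed_eq {M : VonNeumannAlgebra K} (φ : M →ₚ[ℂ] ℂ) (x : M) :
    gnsEmbed φ x = ((φ.toPreGNS x : φ.PreGNS) : φ.GNS) := by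
  simp [gnsEmbed, gnsVector]

/-- The map `x ζ_φ ↦ τ(x) ζ_φ` before completion. -/
noncomputable def preContraction {M : VonNeumannAlgebra K} {φ : M →ₚ[ℂ] ℂ} {τ : M →ₚ[ℂ] M}
    (hτ : τ ∈ PHalf φ) : φ.PreGNS →L[ℂ] φ.PreGNS :=
  LinearMap.mkContinuous
    (φ.toPreGNS.toLinearMap ∘ₗ τ.toLinearMap ∘ₗ φ.ofPreGNS.toLinearMap) 1 fun x => by
      have h := hτ.2.2 (φ.ofPreGNS x)
      rw [map_star τ] at h
      rw [one_mul, PositiveLinearMap.preGNS_norm_def, PositiveLinearMap.preGNS_norm_def]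
      exact Real.sqrt_le_sqrt (Complex.le_def.mp h).1

/-- The bounded operator `T` on the GNS space with `T x ζ_φ = τ(x) ζ_φ`. -/
noncomputable def gnsContraction {M : VonNeumannAlgebra K} {φ : M →ₚ[ℂ] ℂ} {τ : M →ₚ[ℂ] M}
    (hτ : τ ∈ PHalf φ) : φ.GNS →L[ℂ] φ.GNS :=
  (preContraction hτ).completion

theorem gnsContraction_gnsEmbed {M : VonNeumannAlgebra K} {φ : M →ₚ[ℂ] ℂ} {τ : M →ₚ[ℂ] M}
    (hτ : τ ∈ PHalf φ) (x : M) : gnsContraction hτ (gnsEmbed φ x) = gnsEmbed φ (τ x) := by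
  rw [gnsEmbed_eq, gnsEmbed_eq, gnsContraction, ContinuousLinearMap.completion_apply_coe]
  rfl

/-- The closed subspace `{f : T f = f}` of a Hilbert space. -/
noncomputable def invariantVectors {H : Type u} [NormedAddCommGroup H] [InnerProductSpace ℂ H]
    (T : H →L[ℂ] H) : Submodule ℂ H :=
  (T - ContinuousLinearMap.id ℂ H).ker

instance {H : Type u} [NormedAddCommGroup H] [InnerProductSpace ℂ H] [CompleteSpace H]
    (T : H →L[ℂ] H) : CompleteSpace (invariantVectors T) :=
  inferInstanceAs (CompleteSpace (T - ContinuousLinearMap.id ℂ H).ker)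

end VNErgodic

namespace VNErgodic

universe u

/-! ### Convergence of bounded families of operators, and the mean ergodic theorem -/

/-! On the GNS space the averages `s_n` become the averages of the contraction `T`, so the mean
ergodic theorem gives `s_n(x)ζ → P(xζ)`. The `s_n(x)` are bounded in `M`, which is the dual of its
predual (`exists_eq_apply`); a weak-⋆ limit along an ultrafilter is therefore an element `E(x)` of
`M` with `E(x)ζ = P(xζ)`. Since `φ` is faithful, `x ↦ xζ` is injective, so this identity determines
`E` and yields its range and (a).

For norm convergence, the functionals `⟪f, ·ζ⟫` are dense in the predual, and on them composition
with `s_n` is the average of the adjoint `T*` applied to `f`. A Hilbert space contraction and its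
adjoint have the same fixed vectors, so these averages converge in norm to `P f`; uniform bounds
extend this to the whole predual.

For (b), if `N` is an algebra then the operators `π(y)`, `y ∈ N`, and their adjoints preserve the
range of `P`, hence commute with `P`. Conversely the bimodule identity makes `N` a norm-closed
unital star algebra, and `N'' = N` remains. A self-adjoint `x ∈ N''` is a strong limit of
self-adjoint `y ∈ N`, possibly unbounded; the resolvents `(y - i)⁻¹` are bounded by 1, lie in `N`
and converge strongly to `(x - i)⁻¹`. Normality of `E` puts this limit in `N`, hence also `x`.
Finally, `E` and `τ` have the same fixed points, in particular for the element `1`. -/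

theorem isClosed_setOf_tendsto_zero {ι X Y : Type*} [SeminormedAddCommGroup X] [NormedSpace ℂ X]
    [SeminormedAddCommGroup Y] [NormedSpace ℂ Y] {F : Filter ι} {L : ι → X →L[ℂ] Y} {C : ℝ}
    (hL : ∀ i, ‖L i‖ ≤ C) : IsClosed {x | Tendsto (fun i => L i x) F (𝓝 0)} := by
  rw [← isSeqClosed_iff_isClosed]
  intro x a hx hxa
  simp only [Set.mem_ofPred_eq, Metric.tendsto_nhds] at hx ⊢
  intro ε hε
  have hC : 0 < |C| + 1 := by positivity
  obtain ⟨n, hn⟩ := (Metric.tendsto_nhds.1 hxa (ε / 2 / (|C| + 1)) (by positivity)).exists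
  filter_upwards [hx n (ε / 2) (by positivity)] with i hi
  rw [dist_zero_right] at hi ⊢
  rw [dist_comm, dist_eq_norm, lt_div_iff₀ hC] at hn
  have h1 : ‖L i (a - x n)‖ ≤ ‖a - x n‖ * (|C| + 1) := by
    refine ((L i).le_opNorm _).trans ?_
    rw [mul_comm]
    gcongr
    exact (hL i).trans ((le_abs_self C).trans (by linarith))
  calc ‖L i a‖ = ‖L i (a - x n) + L i (x n)‖ := by rw [map_sub, sub_add_cancel]
    _ ≤ ‖L i (a - x n)‖ + ‖L i (x n)‖ := norm_add_le _ _
    _ < ε := by linarith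

/-- The subspace on which a family of operators converges strongly to zero. -/
def tendstoZero {ι X Y : Type*} [SeminormedAddCommGroup X] [NormedSpace ℂ X]
    [SeminormedAddCommGroup Y] [NormedSpace ℂ Y] (L : ι → X →L[ℂ] Y) (F : Filter ι) :
    Submodule ℂ X where
  carrier := {x | Tendsto (fun i => L i x) F (𝓝 0)}
  add_mem' {a b} (ha : Tendsto _ _ _) (hb : Tendsto _ _ _) := by simpa using ha.add hb
  zero_mem' := by simp [tendsto_const_nhds]
  smul_mem' c a (ha : Tendsto _ _ _) := by simpa using ha.const_smul c

theorem mem_tendstoZero {ι X Y : Type*} [SeminormedAddCommGroup X] [NormedSpace ℂ X]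
    [SeminormedAddCommGroup Y] [NormedSpace ℂ Y] {L : ι → X →L[ℂ] Y} {F : Filter ι} {x : X} :
    x ∈ tendstoZero L F ↔ Tendsto (fun i => L i x) F (𝓝 0) := Iff.rfl

theorem isClosed_tendstoZero {ι X Y : Type*} [SeminormedAddCommGroup X] [NormedSpace ℂ X]
    [SeminormedAddCommGroup Y] [NormedSpace ℂ Y] {L : ι → X →L[ℂ] Y} {F : Filter ι} {C : ℝ}
    (hL : ∀ i, ‖L i‖ ≤ C) : IsClosed (tendstoZero L F : Set X) :=
  isClosed_setOf_tendsto_zero hL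

section Precomp

variable {X : Type*} [NormedAddCommGroup X] [NormedSpace ℂ X]

/-- The transpose of a bounded operator. -/
noncomputable def precomp (σ : X →L[ℂ] X) : StrongDual ℂ X →L[ℂ] StrongDual ℂ X :=
  (ContinuousLinearMap.compL ℂ X X ℂ).flip σ

theorem precomp_apply (σ : X →L[ℂ] X) (ψ : StrongDual ℂ X) : precomp σ ψ = ψ.comp σ := rfl

theorem norm_precomp_le (σ : X →L[ℂ] X) : ‖precomp σ‖ ≤ ‖σ‖ :=
  ContinuousLinearMap.opNorm_le_bound _ (norm_nonneg _) fun ψ => by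
    rw [precomp_apply, mul_comm]
    exact ψ.opNorm_comp_le σ

/-- The functionals whose composition with `σ` lies in `W`. -/
noncomputable def comapPrecomp (σ : X →L[ℂ] X) (W : Submodule ℂ (StrongDual ℂ X)) :
    Submodule ℂ (StrongDual ℂ X) :=
  W.comap (precomp σ).toLinearMap

theorem mem_comapPrecomp {σ : X →L[ℂ] X} {W : Submodule ℂ (StrongDual ℂ X)} {ψ : StrongDual ℂ X} :
    ψ ∈ comapPrecomp σ W ↔ ψ.comp σ ∈ W := Iff.rfl

theorem isClosed_comapPrecomp (σ : X →L[ℂ] X) {W : Submodule ℂ (StrongDual ℂ X)}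
    (hW : IsClosed (W : Set (StrongDual ℂ X))) :
    IsClosed (comapPrecomp σ W : Set (StrongDual ℂ X)) :=
  hW.preimage (precomp σ).continuous

/-- The subspace of functionals on which the compositions with `σ i` converge in norm to the
composition with `σ'`. -/
noncomputable def tendstoPrecomp {ι : Type*} (σ : ι → X →L[ℂ] X) (σ' : X →L[ℂ] X)
    (F : Filter ι) : Submodule ℂ (StrongDual ℂ X) :=
  tendstoZero (fun i => precomp (σ i) - precomp σ') F

theorem mem_tendstoPrecomp {ι : Type*} {σ : ι → X →L[ℂ] X} {σ' : X →L[ℂ] X} {F : Filter ι}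
    {ψ : StrongDual ℂ X} : ψ ∈ tendstoPrecomp σ σ' F ↔
      Tendsto (fun i => ‖ψ.comp (σ i) - ψ.comp σ'‖) F (𝓝 0) := by
  rw [tendstoPrecomp, mem_tendstoZero, tendsto_zero_iff_norm_tendsto_zero]
  rfl

theorem isClosed_tendstoPrecomp {ι : Type*} {σ : ι → X →L[ℂ] X} {σ' : X →L[ℂ] X} {F : Filter ι}
    {C C' : ℝ} (hσ : ∀ i, ‖σ i‖ ≤ C) (hσ' : ‖σ'‖ ≤ C') :
    IsClosed (tendstoPrecomp σ σ' F : Set (StrongDual ℂ X)) :=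
  isClosed_tendstoZero (C := C + C') fun i => (norm_sub_le _ _).trans
    (add_le_add ((norm_precomp_le _).trans (hσ i)) ((norm_precomp_le _).trans hσ'))

end Precomp

/-- A closed subspace is separated from the points outside it by bounded functionals. -/
theorem exists_dual_eq_zero_of_notMem {X : Type*} [SeminormedAddCommGroup X] [NormedSpace ℂ X]
    {V : Submodule ℂ X} (hV : IsClosed (V : Set X)) {x : X} (hx : x ∉ V) :
    ∃ F : StrongDual ℂ X, (∀ v ∈ V, F v = 0) ∧ F x ≠ 0 := by
  -- Pass to the quotient by `V`: closedness makes the class of `x` have nonzero norm, and a norming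
  -- functional for it pulls back.
  have h : ‖V.mkQL x‖ ≠ 0 := by
    intro h
    exact hx ((QuotientAddGroup.norm_mk_eq_zero (S := V.toAddSubgroup) (hS := hV)).1 h)
  obtain ⟨f, -, hf⟩ := exists_dual_vector ℂ (V.mkQL x) h
  refine ⟨f ∘L V.mkQL, fun v hv => ?_, ?_⟩
  · change f (V.mkQ v) = 0
    rw [Submodule.mkQ_apply, (Submodule.Quotient.mk_eq_zero V).2 hv, map_zero]
  · change f (V.mkQL x) ≠ 0
    rw [hf]
    exact Complex.ofReal_ne_zero.2 h

/-- Bounded sequences in a normed space converge weak-⋆ in the bidual along ultrafilters. -/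
theorem exists_tendsto_ultrafilter_bidual {ι X : Type*} [NormedAddCommGroup X] [NormedSpace ℂ X]
    (U : Ultrafilter ι) {v : ι → X} {C : ℝ} (hv : ∀ i, ‖v i‖ ≤ C) :
    ∃ F : StrongDual ℂ (StrongDual ℂ X), ∀ ψ : StrongDual ℂ X,
      Tendsto (fun i => ψ (v i)) U (𝓝 (F ψ)) := by
  let ev : X → WeakDual ℂ (StrongDual ℂ X) := fun x =>
    StrongDual.toWeakDual (ContinuousLinearMap.apply ℂ ℂ x)
  have hev : ∀ i, ev (v i) ∈
      WeakDual.toStrongDual ⁻¹' Metric.closedBall (0 : StrongDual ℂ (StrongDual ℂ X)) C := by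
    intro i
    refine (mem_closedBall_zero_iff (E := StrongDual ℂ (StrongDual ℂ X))).2 ?_
    refine ContinuousLinearMap.opNorm_le_bound _ ((norm_nonneg _).trans (hv i)) fun ψ => ?_
    rw [mul_comm]
    exact ψ.le_of_opNorm_le_of_le le_rfl (hv i)
  obtain ⟨F, -, hF⟩ := (WeakDual.isCompact_closedBall (𝕜 := ℂ)
    (0 : StrongDual ℂ (StrongDual ℂ X)) C).ultrafilter_le_nhds' (U.map fun i => ev (v i))
    (Ultrafilter.mem_map.2 (Filter.Eventually.of_forall hev))
  exact ⟨WeakDual.toStrongDual F, fun ψ =>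
    ((WeakDual.eval_continuous (𝕜 := ℂ) ψ).tendsto F).comp hF⟩

/-! ### Invariant vectors and averages of a Hilbert space contraction -/

section Hilbert

variable {H : Type u} [NormedAddCommGroup H] [InnerProductSpace ℂ H]

theorem mem_invariantVectors {T : H →L[ℂ] H} {x : H} : x ∈ invariantVectors T ↔ T x = x := by
  change (T - ContinuousLinearMap.id ℂ H) x = 0 ↔ _
  rw [sub_apply, sub_eq_zero]
  rfl

theorem isClosed_invariantVectors (T : H →L[ℂ] H) : IsClosed (invariantVectors T : Set H) :=
  (T - ContinuousLinearMap.id ℂ H).isClosed_ker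

theorem mapsTo_invariantVectors {T : H →L[ℂ] H} {s : Set H}
    (hs : invariantVectors T = (Submodule.span ℂ s).topologicalClosure) {A : H →L[ℂ] H}
    (hA : ∀ f ∈ s, A f ∈ invariantVectors T) : ∀ f ∈ invariantVectors T, A f ∈ invariantVectors T := by
  have hle : (Submodule.span ℂ s).topologicalClosure ≤ (invariantVectors T).comap A.toLinearMap :=
    Submodule.topologicalClosure_minimal _ (Submodule.span_le.2 hA)
      ((isClosed_invariantVectors T).preimage A.continuous)
  rw [← hs] at hle
  exact hle

/-- The average `(1/n) ∑_{k < n} T^k`. -/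
noncomputable def average (T : H →L[ℂ] H) (n : ℕ) : H →L[ℂ] H :=
  (n : ℂ)⁻¹ • ∑ k ∈ Finset.range n, T ^ k

theorem norm_average_le {T : H →L[ℂ] H} (hT : ‖T‖ ≤ 1) (n : ℕ) : ‖average T n‖ ≤ 1 := by
  rcases eq_or_ne n 0 with rfl | hn
  · simp [average]
  have h : ‖∑ k ∈ Finset.range n, T ^ k‖ ≤ n := by
    refine (norm_sum_le_of_le (f := fun k => T ^ k) (n := fun _ => (1 : ℝ)) _ fun k _ => ?_).trans
      (by simp)
    refine ContinuousLinearMap.opNorm_le_bound _ zero_le_one fun x => ?_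
    rw [one_mul]
    clear * - hT
    induction k with
    | zero => simp
    | succ k ih =>
      rw [pow_succ']
      exact (T.le_of_opNorm_le hT _).trans ((one_mul _).le.trans ih)
  rw [average, norm_smul, norm_inv, Complex.norm_natCast]
  have : (0 : ℝ) < n := by positivity
  rw [inv_mul_le_iff₀ this]
  simpa using h

variable [CompleteSpace H]

theorem tendsto_average {T : H →L[ℂ] H} (hT : ‖T‖ ≤ 1) (x : H) :
    Tendsto (fun n => average T n x) atTop (𝓝 ((invariantVectors T).starProjection x)) := by
  have h := T.tendsto_birkhoffAverage_orthogonalProjection hT x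
  have h1 : T.eqLocus (1 : H →L[ℂ] H) = invariantVectors T := by
    ext y
    rw [mem_invariantVectors]
    rfl
  have h2 : ((T.eqLocus (1 : H →L[ℂ] H)).orthogonalProjectionOnto x : H)
      = (invariantVectors T).starProjection x := by
    rw [← Submodule.starProjection_apply]
    congr
  rw [h2] at h
  refine h.congr fun n => ?_
  simp [birkhoffAverage, birkhoffSum, average]

/-- Equality case of Cauchy–Schwarz: if `T x = x` then `⟪T* x, x⟫ = ‖x‖²` while `‖T* x‖ ≤ ‖x‖`,
which forces `T* x = x`. -/
theorem invariantVectors_le_adjoint {T : H →L[ℂ] H} (hT : ‖T‖ ≤ 1) :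
    invariantVectors T ≤ invariantVectors (ContinuousLinearMap.adjoint T) := by
  intro x hx
  rw [mem_invariantVectors] at hx ⊢
  refine eq_of_norm_le_re_inner_eq_norm_sq (𝕜 := ℂ) ?_ ?_
  · have h : ‖ContinuousLinearMap.adjoint T‖ ≤ 1 := by
      rwa [LinearIsometryEquiv.norm_map]
    simpa using (ContinuousLinearMap.adjoint T).le_of_opNorm_le h x
  · rw [ContinuousLinearMap.adjoint_inner_left, hx]
    exact inner_self_eq_norm_sq x

theorem invariantVectors_adjoint {T : H →L[ℂ] H} (hT : ‖T‖ ≤ 1) :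
    invariantVectors (ContinuousLinearMap.adjoint T) = invariantVectors T := by
  refine le_antisymm ?_ (invariantVectors_le_adjoint hT)
  have h := invariantVectors_le_adjoint (T := ContinuousLinearMap.adjoint T)
    (by rwa [LinearIsometryEquiv.norm_map])
  rwa [ContinuousLinearMap.adjoint_adjoint] at h

theorem adjoint_average (T : H →L[ℂ] H) (n : ℕ) :
    ContinuousLinearMap.adjoint (average T n) = average (ContinuousLinearMap.adjoint T) n := by
  simp only [← ContinuousLinearMap.star_eq_adjoint, average, star_smul, star_sum, star_pow]
  simp

theorem adjoint_starProjection (U : Submodule ℂ H) [U.HasOrthogonalProjection] :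
    ContinuousLinearMap.adjoint U.starProjection = U.starProjection :=
  (isSelfAdjoint_starProjection U).star_eq

theorem starProjection_apply_of_mapsTo (U : Submodule ℂ H) [U.HasOrthogonalProjection]
    (A : H →L[ℂ] H) (h1 : ∀ v ∈ U, A v ∈ U) (h2 : ∀ v ∈ U, ContinuousLinearMap.adjoint A v ∈ U)
    (v : H) : U.starProjection (A v) = A (U.starProjection v) := by
  refine Submodule.eq_starProjection_of_mem_of_inner_eq_zero
    (h1 _ (Submodule.starProjection_apply_mem U v)) (fun w hw => ?_)
  rw [← map_sub, ← ContinuousLinearMap.adjoint_inner_right]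
  exact Submodule.starProjection_inner_eq_zero v _ (h2 w hw)

/-! ### The double commutant theorem -/

variable (S : StarSubalgebra ℂ (H →L[ℂ] H))

section Amplification

variable {ι : Type*} [Fintype ι]

/-- The diagonal action of an operator on a finite direct sum of copies of the Hilbert space. -/
noncomputable def diagonal (y : H →L[ℂ] H) :
    PiLp 2 (fun _ : ι => H) →L[ℂ] PiLp 2 (fun _ : ι => H) :=
  (PiLp.continuousLinearEquiv 2 ℂ (fun _ : ι => H)).symm.toContinuousLinearMap ∘L
    ContinuousLinearMap.pi fun i => y ∘L PiLp.proj 2 (fun _ : ι => H) i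

omit [CompleteSpace H] [Fintype ι] in
theorem diagonal_apply (y : H →L[ℂ] H) (v : PiLp 2 (fun _ : ι => H)) (i : ι) :
    diagonal y v i = y (v i) := rfl

theorem adjoint_diagonal (y : H →L[ℂ] H) :
    ContinuousLinearMap.adjoint (diagonal (ι := ι) y) =
      diagonal (ContinuousLinearMap.adjoint y) := by
  symm
  rw [ContinuousLinearMap.eq_adjoint_iff]
  intro v w
  simp [PiLp.inner_apply, diagonal_apply, ContinuousLinearMap.adjoint_inner_left]

/-- An operator commuting with the diagonal action of `S` commutes with the diagonal action of the
double commutant of `S`. -/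
theorem diagonal_comm_of_mem_centralizer
    {P : PiLp 2 (fun _ : ι => H) →L[ℂ] PiLp 2 (fun _ : ι => H)}
    (hP : ∀ y ∈ S, ∀ v, P (diagonal y v) = diagonal y (P v)) {x : H →L[ℂ] H}
    (hx : x ∈ Set.centralizer (Set.centralizer (S : Set (H →L[ℂ] H))))
    (v : PiLp 2 (fun _ : ι => H)) : P (diagonal x v) = diagonal x (P v) := by
  classical
  -- Write `P` as a matrix of operators on `H`. Commuting with the diagonal action of `S` means that
  -- every entry lies in `S'`, so every entry commutes with `x`.
  let e : ι → H →L[ℂ] PiLp 2 (fun _ : ι => H) := fun j =>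
    (PiLp.continuousLinearEquiv 2 ℂ (fun _ : ι => H)).symm.toContinuousLinearMap ∘L
      ContinuousLinearMap.single ℂ (fun _ : ι => H) j
  let entry : ι → ι → H →L[ℂ] H := fun i j => PiLp.proj 2 (fun _ : ι => H) i ∘L P ∘L e j
  have he : ∀ (z : H →L[ℂ] H) j a, e j (z a) = diagonal z (e j a) := by
    intro z j a
    ext i
    rw [diagonal_apply]
    change Pi.single (M := fun _ : ι => H) j (z a) i = z (Pi.single (M := fun _ : ι => H) j a i)
    by_cases h : i = j
    · subst h; simp
    · simp [Pi.single_eq_of_ne h]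
  have hsum : ∀ w : PiLp 2 (fun _ : ι => H), w = ∑ j, e j (w j) := by
    intro w
    ext i
    rw [WithLp.ofLp_sum, Finset.sum_apply]
    change w i = ∑ j, Pi.single (M := fun _ : ι => H) j (w j) i
    rw [Finset.sum_pi_single]
    simp
  have hentry : ∀ w i, P w i = ∑ j, entry i j (w j) := by
    intro w i
    conv_lhs => rw [hsum w, map_sum, WithLp.ofLp_sum, Finset.sum_apply]
    rfl
  have hmem : ∀ i j, entry i j ∈ Set.centralizer (S : Set (H →L[ℂ] H)) := by
    intro i j y hy
    ext a
    change y (P (e j a) i) = P (e j (y a)) i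
    rw [he, hP y hy, diagonal_apply]
  ext i
  rw [hentry, diagonal_apply, hentry, map_sum]
  exact Finset.sum_congr rfl fun j _ => congr($(hx _ (hmem i j)) (v j))

/-- Elements of the double commutant of `S` are approximated by elements of `S` on finitely many
vectors. -/
theorem mem_closure_of_mem_centralizer_centralizer {x : H →L[ℂ] H}
    (hx : x ∈ Set.centralizer (Set.centralizer (S : Set (H →L[ℂ] H)))) (g : ι → H) :
    (fun i => x (g i)) ∈ closure ((fun (y : H →L[ℂ] H) i => y (g i)) '' (S : Set (H →L[ℂ] H))) := by
  let G : PiLp 2 (fun _ : ι => H) := WithLp.toLp 2 g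
  let ev : (H →L[ℂ] H) →ₗ[ℂ] PiLp 2 (fun _ : ι => H) :=
    { toFun := fun y => diagonal y G
      map_add' := fun y z => by ext i; rfl
      map_smul' := fun c y => by ext i; rfl }
  -- The closed cyclic subspace of `G` reduces the diagonal action of `S`, so its projection
  -- commutes with `S` and therefore with `S''`. As `1 ∈ S`, it contains `G`, hence also `x G`.
  let V : Submodule ℂ (PiLp 2 (fun _ : ι => H)) :=
    ((Subalgebra.toSubmodule S.toSubalgebra).map ev).topologicalClosure
  have hV : ∀ y ∈ S, ∀ v ∈ V, diagonal y v ∈ V := by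
    intro y hy v hv
    refine map_mem_closure (diagonal y).continuous hv ?_
    rintro _ ⟨z, hz, rfl⟩
    exact ⟨y * z, S.mul_mem hy hz, rfl⟩
  have hcomm := diagonal_comm_of_mem_centralizer S (P := V.starProjection)
    (fun y hy v => starProjection_apply_of_mapsTo V (diagonal y) (hV y hy) (fun w hw => by
      rw [adjoint_diagonal]
      exact hV _ (star_mem (s := S) hy) w hw) v) hx G
  have hG : G ∈ V := Submodule.le_topologicalClosure _ ⟨1, S.one_mem, rfl⟩
  rw [Submodule.starProjection_eq_self_iff.2 hG, Submodule.starProjection_eq_self_iff] at hcomm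
  refine map_mem_closure (PiLp.continuous_ofLp 2 (fun _ : ι => H)) hcomm ?_
  rintro _ ⟨z, hz, rfl⟩
  exact ⟨z, hz, rfl⟩

/-- Self-adjoint elements of the double commutant of `S` are approximated by self-adjoint elements
of `S` on finitely many vectors. -/
theorem mem_closure_selfAdjoint_of_mem_centralizer_centralizer {x : H →L[ℂ] H}
    (hx : x ∈ Set.centralizer (Set.centralizer (S : Set (H →L[ℂ] H)))) (hxs : IsSelfAdjoint x)
    (g : ι → H) :
    (fun i => x (g i)) ∈
      closure ((fun (y : H →L[ℂ] H) i => y (g i)) '' {y | y ∈ S ∧ IsSelfAdjoint y}) := by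
  classical
  by_contra hcon
  have hconv : Convex ℝ ((fun (y : H →L[ℂ] H) i => y (g i)) '' {y | y ∈ S ∧ IsSelfAdjoint y}) := by
    have : Convex ℝ {y : H →L[ℂ] H | y ∈ S ∧ IsSelfAdjoint y} := by
      intro a ha b hb s t _ _ _
      refine ⟨S.add_mem ?_ ?_, ((IsSelfAdjoint.all s).smul ha.2).add
        ((IsSelfAdjoint.all t).smul hb.2)⟩
      · rw [← Complex.coe_smul]
        exact S.smul_mem ha.1 _
      · rw [← Complex.coe_smul]
        exact S.smul_mem hb.1 _
    exact this.is_linear_image (f := fun (y : H →L[ℂ] H) i => y (g i))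
      ⟨fun _ _ => rfl, fun _ _ => rfl⟩
  -- Symmetrising `y` into `(y + y*)/2` does not preserve strong convergence, but it preserves weak
  -- convergence; since the set is convex, Hahn–Banach makes weak approximation enough.
  obtain ⟨f, c, hf, hfx⟩ := RCLike.geometric_hahn_banach_closed_point (𝕜 := ℂ)
    hconv.closure isClosed_closure hcon
  let v : ι → H := fun i => (InnerProductSpace.toDual ℂ H).symm
    (f ∘L ContinuousLinearMap.single ℂ (fun _ : ι => H) i)
  have hfv : ∀ w : ι → H, f w = ∑ i, ⟪v i, w i⟫_ℂ := by
    intro w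
    conv_lhs => rw [← LinearMap.sum_single_apply (fun _ : ι => H) w, map_sum]
    refine Finset.sum_congr rfl fun i _ => ?_
    rw [InnerProductSpace.toDual_symm_apply]
    rfl
  -- Approximating on the vectors `v i` as well controls the adjoints, through `⟪y v, g⟫ = ⟪v, y*
  -- g⟫`.
  have hcl := mem_closure_of_mem_centralizer_centralizer S hx (Sum.elim g v)
  obtain ⟨w, hw, hlim⟩ := mem_closure_iff_seq_limit.1 hcl
  choose y hyS hyw using hw
  obtain rfl : w = fun n i => y n (Sum.elim g v i) := funext fun n => (hyw n).symm
  rw [tendsto_pi_nhds] at hlim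
  have h1 : Tendsto (fun n => ∑ i, ⟪v i, y n (g i)⟫_ℂ + ∑ i, ⟪y n (v i), g i⟫_ℂ) atTop
      (𝓝 (∑ i, ⟪v i, x (g i)⟫_ℂ + ∑ i, ⟪x (v i), g i⟫_ℂ)) :=
    (tendsto_finsetSum _ fun i _ => tendsto_const_nhds.inner (hlim (Sum.inl i))).add
      (tendsto_finsetSum _ fun i _ => (hlim (Sum.inr i)).inner tendsto_const_nhds)
  have hadj : ∀ (z : H →L[ℂ] H) i, ⟪z (v i), g i⟫_ℂ = ⟪v i, star z (g i)⟫_ℂ := fun z i =>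
    (ContinuousLinearMap.adjoint_inner_right z (v i) (g i)).symm
  have hkey : ∀ z : H →L[ℂ] H, ∑ i, ⟪v i, z (g i)⟫_ℂ + ∑ i, ⟪z (v i), g i⟫_ℂ =
      f (fun i => (z + star z) (g i)) := by
    intro z
    rw [hfv, ← Finset.sum_add_distrib]
    refine Finset.sum_congr rfl fun i _ => ?_
    rw [hadj, add_apply, inner_add_right]
  have h2 : Tendsto (fun n => RCLike.re (f fun i => (y n + star (y n)) (g i))) atTop
      (𝓝 (RCLike.re (f fun i => (x + star x) (g i)))) := by
    simp only [hkey] at h1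
    exact (RCLike.continuous_re.tendsto _).comp h1
  have h3 : ∀ n, RCLike.re (f fun i => (y n + star (y n)) (g i)) ≤ 2 * c := by
    intro n
    have := hf (fun i => ((2 : ℂ)⁻¹ • (y n + star (y n))) (g i)) (subset_closure
      ⟨_, ⟨S.smul_mem (S.add_mem (hyS n) (star_mem (s := S) (hyS n))) _, ?_⟩, rfl⟩)
    · have he : (fun i => (y n + star (y n)) (g i)) =
          ((2 : ℝ) : ℂ) • fun i => ((2 : ℂ)⁻¹ • (y n + star (y n))) (g i) := by
        ext i
        simp [smul_smul]
      rw [he, map_smul, smul_eq_mul]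
      have hr : ∀ z : ℂ, RCLike.re (((2 : ℝ) : ℂ) * z) = 2 * RCLike.re z := fun z => by
        simp
      rw [hr]
      linarith
    · rw [isSelfAdjoint_iff, star_smul, star_add, star_star, add_comm]
      congr 1
      simp
  have h4 := le_of_tendsto' h2 h3
  have h5 : (fun i => (x + star x) (g i)) = ((2 : ℝ) : ℂ) • fun i => x (g i) := by
    ext i
    rw [hxs.star_eq, ← two_smul ℂ x]
    simp
  have hr : ∀ z : ℂ, RCLike.re (((2 : ℝ) : ℂ) * z) = 2 * RCLike.re z := fun z => by simp
  rw [h5, map_smul, smul_eq_mul, hr] at h4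
  linarith

end Amplification

/-! ### Strong convergence and resolvents -/

/-- The filter of self-adjoint elements of `S` converging strongly to `x`. -/
noncomputable def strongNhds (x : H →L[ℂ] H) : Filter {y : H →L[ℂ] H // y ∈ S ∧ IsSelfAdjoint y} :=
  comap (fun y (g : H) => y.1 g) (𝓝 ⇑x)

theorem tendsto_strongNhds (x : H →L[ℂ] H) (g : H) :
    Tendsto (fun y : {y : H →L[ℂ] H // y ∈ S ∧ IsSelfAdjoint y} => y.1 g) (strongNhds S x)
      (𝓝 (x g)) :=
  ((continuous_apply g).tendsto (x : H → H)).comp tendsto_comap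

theorem strongNhds_neBot {x : H →L[ℂ] H}
    (hx : x ∈ Set.centralizer (Set.centralizer (S : Set (H →L[ℂ] H)))) (hxs : IsSelfAdjoint x) :
    (strongNhds S x).NeBot := by
  rw [strongNhds, comap_neBot_iff]
  intro t ht
  obtain ⟨o, hot, ho, hxo⟩ := mem_nhds_iff.1 ht
  obtain ⟨I, w, hw, hIw⟩ := isOpen_pi_iff.1 ho _ hxo
  obtain ⟨_, h1, y, hy, rfl⟩ := mem_closure_iff.1
    (mem_closure_selfAdjoint_of_mem_centralizer_centralizer S hx hxs (fun i : I => (i : H)))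
    (Set.univ.pi fun i : I => w i) (isOpen_set_pi Set.finite_univ fun i _ => (hw i i.2).1)
    (fun i _ => (hw i i.2).2)
  exact ⟨⟨y, hy⟩, hot (hIw fun a ha => h1 ⟨a, ha⟩ trivial)⟩

/-- The resolvent `(y - i)⁻¹`. -/
noncomputable def resolventI (y : H →L[ℂ] H) : H →L[ℂ] H :=
  Ring.inverse (y - algebraMap ℂ (H →L[ℂ] H) Complex.I)

theorem isUnit_sub_I {y : H →L[ℂ] H} (hy : IsSelfAdjoint y) :
    IsUnit (y - algebraMap ℂ (H →L[ℂ] H) Complex.I) := by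
  have h : Complex.I ∉ spectrum ℂ y := fun h => by
    have := hy.mem_spectrum_eq_re h
    simp at this
  rw [spectrum.mem_iff, not_not] at h
  rw [← neg_sub]
  exact h.neg

theorem sub_I_resolventI {y : H →L[ℂ] H} (hy : IsSelfAdjoint y) (g : H) :
    (y - algebraMap ℂ (H →L[ℂ] H) Complex.I) (resolventI y g) = g :=
  congr($(Ring.mul_inverse_cancel _ (isUnit_sub_I hy)) g)

theorem resolventI_sub_I {y : H →L[ℂ] H} (hy : IsSelfAdjoint y) (g : H) :
    resolventI y ((y - algebraMap ℂ (H →L[ℂ] H) Complex.I) g) = g :=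
  congr($(Ring.inverse_mul_cancel _ (isUnit_sub_I hy)) g)

/-- Because `⟪y g, g⟫` is real, the cross term vanishes and `‖(y - i) g‖² = ‖y g‖² + ‖g‖²`. -/
theorem norm_le_norm_sub_I {y : H →L[ℂ] H} (hy : IsSelfAdjoint y) (g : H) :
    ‖g‖ ≤ ‖(y - algebraMap ℂ (H →L[ℂ] H) Complex.I) g‖ := by
  have h1 : (y - algebraMap ℂ (H →L[ℂ] H) Complex.I) g = y g - Complex.I • g := by
    rw [sub_apply, Algebra.algebraMap_eq_smul_one]
    rfl
  have h2 : (RCLike.re ⟪y g, Complex.I • g⟫_ℂ : ℝ) = 0 := by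
    have : (starRingEnd ℂ) ⟪y g, g⟫_ℂ = ⟪y g, g⟫_ℂ := by
      rw [inner_conj_symm, ← ContinuousLinearMap.adjoint_inner_left,
        ← ContinuousLinearMap.star_eq_adjoint, hy.star_eq]
    rw [inner_smul_right]
    have := Complex.conj_eq_iff_im.1 this
    simp [this]
  have h3 := @norm_sub_sq ℂ H _ _ _ (y g) (Complex.I • g)
  rw [h2, norm_smul, Complex.norm_I, one_mul] at h3
  rw [h1]
  refine abs_le_of_sq_le_sq' ?_ (norm_nonneg _) |>.2
  nlinarith [sq_nonneg ‖y g‖]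

theorem norm_resolventI_le {y : H →L[ℂ] H} (hy : IsSelfAdjoint y) : ‖resolventI y‖ ≤ 1 := by
  refine ContinuousLinearMap.opNorm_le_bound _ zero_le_one fun g => ?_
  rw [one_mul]
  refine (norm_le_norm_sub_I hy _).trans ?_
  rw [sub_I_resolventI hy]

/-- Resolvent identity: the difference is `(y - i)⁻¹ (x - y) (x - i)⁻¹ g`. The left factor has norm
at most 1, so convergence of `y` at the single vector `(x - i)⁻¹ g` suffices and no bound on `y` is
needed. -/
theorem tendsto_resolventI {x : H →L[ℂ] H} (hx : IsSelfAdjoint x) (g : H) :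
    Tendsto (fun y : {y : H →L[ℂ] H // y ∈ S ∧ IsSelfAdjoint y} => resolventI y.1 g)
      (strongNhds S x) (𝓝 (resolventI x g)) := by
  rw [tendsto_iff_norm_sub_tendsto_zero]
  have h := tendsto_strongNhds S x (resolventI x g)
  rw [tendsto_iff_norm_sub_tendsto_zero] at h
  refine squeeze_zero (fun _ => norm_nonneg _) (fun y => ?_) h
  have h1 : resolventI y.1 g - resolventI x g =
      resolventI y.1 (x (resolventI x g) - y.1 (resolventI x g)) := by
    have h2 : x (resolventI x g) - y.1 (resolventI x g) =
        g - (y.1 - algebraMap ℂ (H →L[ℂ] H) Complex.I) (resolventI x g) := by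
      conv_rhs => rw [← sub_I_resolventI hx g]
      rw [sub_I_resolventI hx g]
      simp only [sub_apply]
      conv_rhs => enter [1]; rw [← sub_I_resolventI hx g]
      simp only [sub_apply]
      abel
    rw [h2, map_sub, resolventI_sub_I y.2.2]
  rw [h1, norm_sub_rev (y.1 _)]
  exact ((resolventI y.1).le_of_opNorm_le (norm_resolventI_le y.2.2) _).trans (by rw [one_mul])

/-- Spectral permanence: a closed star subalgebra contains the inverses of its invertible elements.
Apply it to `y - i` in one direction and to the resolvent in the other. -/
theorem resolventI_mem_iff {S : StarSubalgebra ℂ (H →L[ℂ] H)}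
    (hS : IsClosed (S : Set (H →L[ℂ] H))) {y : H →L[ℂ] H}
    (hy : IsSelfAdjoint y) : resolventI y ∈ S ↔ y ∈ S := by
  have hinv : ∀ {a : H →L[ℂ] H}, IsUnit a → a ∈ S → Ring.inverse a ∈ S := by
    intro a ha haS
    obtain ⟨b, hb⟩ := (StarSubalgebra.coe_isUnit S (a := ⟨a, haS⟩)).1 ha
    have h1 : a * ((b⁻¹ : Sˣ) : S) = 1 := by
      have := b.mul_inv
      rw [hb] at this
      exact congrArg Subtype.val this
    have h2 : Ring.inverse a = ((b⁻¹ : Sˣ) : S) := by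
      calc Ring.inverse a = Ring.inverse a * (a * ((b⁻¹ : Sˣ) : S)) := by rw [h1, mul_one]
        _ = _ := by rw [← mul_assoc, Ring.inverse_mul_cancel _ ha, one_mul]
    rw [h2]
    exact SetLike.coe_mem _
  have hI : algebraMap ℂ (H →L[ℂ] H) Complex.I ∈ S := S.algebraMap_mem _
  constructor
  · intro h
    have h1 := hinv ((isUnit_sub_I hy).ringInverse) h
    rw [Ring.inverse_of_isUnit (isUnit_sub_I hy), Ring.inverse_unit, inv_inv, IsUnit.unit_spec] at h1
    simpa using S.add_mem h1 hI
  · exact fun h => hinv (isUnit_sub_I hy) (S.sub_mem h hI)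

end Hilbert


/-! ### The predual -/

section Predual

variable {K : Type u} [NormedAddCommGroup K] [InnerProductSpace ℂ K] [CompleteSpace K]
variable {M : VonNeumannAlgebra K}

theorem vectorFunctional_apply (f g : K) (x : M) :
    vectorFunctional M f g x = ⟪f, (x : K →L[ℂ] K) g⟫_ℂ := rfl

theorem vectorFunctional_mem_predual (f g : K) : vectorFunctional M f g ∈ predual M :=
  Submodule.le_topologicalClosure _ (Submodule.subset_span ⟨f, g, rfl⟩)

theorem norm_vectorFunctional_le (f g : K) : ‖vectorFunctional M f g‖ ≤ ‖f‖ * ‖g‖ :=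
  LinearMap.mkContinuous_norm_le _ (by positivity) _

theorem vn_ext_inner {x y : M}
    (h : ∀ f g : K, ⟪f, (x : K →L[ℂ] K) g⟫_ℂ = ⟪f, (y : K →L[ℂ] K) g⟫_ℂ) : x = y := by
  ext g
  exact ext_inner_left ℂ fun f => h f g

theorem eq_of_predual {x y : M} (h : ∀ ψ ∈ predual M, ψ x = ψ y) : x = y :=
  vn_ext_inner fun f g => h _ (vectorFunctional_mem_predual f g)

/-- A closed subspace containing the vector functionals contains the predual. -/
theorem predual_le {V : Submodule ℂ (M →L[ℂ] ℂ)} (hV : IsClosed (V : Set (M →L[ℂ] ℂ)))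
    (h : ∀ f g : K, vectorFunctional M f g ∈ V) : predual M ≤ V :=
  Submodule.topologicalClosure_minimal _ (Submodule.span_le.2 (by
    rintro _ ⟨f, g, rfl⟩
    exact h f g)) hV

theorem isClosed_predual : IsClosed (predual M : Set (M →L[ℂ] ℂ)) :=
  Submodule.isClosed_topologicalClosure _

/-- Every bounded functional on the predual is evaluation at an element of the algebra. -/
theorem exists_eq_apply (F : StrongDual ℂ (StrongDual ℂ M)) :
    ∃ y : M, ∀ ψ ∈ predual M, F ψ = ψ y := by
  have hvf : ∀ {f g : K} {ψ : M →L[ℂ] ℂ}, (∀ x : M, ⟪f, (x : K →L[ℂ] K) g⟫_ℂ = ψ x) →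
      F (vectorFunctional M f g) = F ψ :=
    fun h => congrArg F (ContinuousLinearMap.ext h)
  -- On vector functionals `F` is a bounded sesquilinear form, hence given by an operator. It
  -- commutes with each `z ∈ M'` because `⟪z* f, x g⟫ = ⟪f, x z g⟫` for `x ∈ M`, so it lies in `M''
  -- = M`.
  let B₀ : K →ₗ⋆[ℂ] K →ₗ[ℂ] ℂ :=
    LinearMap.mk₂'ₛₗ (starRingEnd ℂ) (RingHom.id ℂ) (fun f g => F (vectorFunctional M f g))
      (fun f₁ f₂ g => by
        rw [← map_add]
        exact hvf fun x => inner_add_left _ _ _)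
      (fun c f g => by
        rw [smul_eq_mul, ← smul_eq_mul, ← map_smul]
        exact hvf fun x => inner_smul_left _ _ _)
      (fun f g₁ g₂ => by
        rw [← map_add]
        refine hvf fun x => ?_
        rw [map_add, inner_add_right]
        rfl)
      (fun c f g => by
        rw [← map_smul]
        refine hvf fun x => ?_
        rw [map_smul, inner_smul_right]
        rfl)
  have hB₀ : ∀ f g, ‖B₀ f g‖ ≤ ‖F‖ * ‖f‖ * ‖g‖ := fun f g => by
    rw [mul_assoc]
    exact F.le_of_opNorm_le_of_le le_rfl (norm_vectorFunctional_le f g)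
  let A := InnerProductSpace.continuousLinearMapOfBilin (B₀.mkContinuous₂ ‖F‖ hB₀)
  have hA : ∀ f g, ⟪f, ContinuousLinearMap.adjoint A g⟫_ℂ = F (vectorFunctional M f g) :=
    fun f g => by
      rw [ContinuousLinearMap.adjoint_inner_right,
        InnerProductSpace.continuousLinearMapOfBilin_apply]
      rfl
  have hmem : ContinuousLinearMap.adjoint A ∈ M := by
    rw [← SetLike.mem_coe, ← M.centralizer_centralizer]
    intro z hz
    ext g
    refine ext_inner_left ℂ fun f => ?_
    change ⟪f, z (ContinuousLinearMap.adjoint A g)⟫_ℂ = ⟪f, ContinuousLinearMap.adjoint A (z g)⟫_ℂ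
    rw [← ContinuousLinearMap.adjoint_inner_left, hA, hA]
    refine hvf fun x => ?_
    rw [ContinuousLinearMap.adjoint_inner_left]
    exact congrArg (fun w => ⟪f, w⟫_ℂ) congr($(hz x x.2) g).symm
  let y : M := ⟨_, hmem⟩
  refine ⟨y, fun ψ hψ => ?_⟩
  let D : StrongDual ℂ (StrongDual ℂ M) := F - ContinuousLinearMap.apply ℂ ℂ y
  have hV : predual M ≤ D.toLinearMap.ker := predual_le D.isClosed_ker fun f g => by
    change F _ - vectorFunctional M f g y = 0
    rw [← hA, sub_eq_zero]
    rfl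
  exact sub_eq_zero.1 (hV hψ)

/-- Bounded sequences converge `σ`-weakly along ultrafilters. -/
theorem exists_tendsto_ultrafilter {ι : Type*} (U : Ultrafilter ι) {v : ι → M} {C : ℝ}
    (hv : ∀ i, ‖v i‖ ≤ C) :
    ∃ y : M, ∀ ψ ∈ predual M, Tendsto (fun i => ψ (v i)) U (𝓝 (ψ y)) := by
  obtain ⟨F, hF⟩ := exists_tendsto_ultrafilter_bidual U hv
  obtain ⟨y, hy⟩ := exists_eq_apply F
  exact ⟨y, fun ψ hψ => hy ψ hψ ▸ hF ψ⟩

/-- A bounded strongly convergent family converges `σ`-weakly. -/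
theorem tendsto_predual_of_strong {ι : Type*} {F : Filter ι} {v : ι → M} {m : M} {C : ℝ}
    (hv : ∀ i, ‖v i‖ ≤ C)
    (h : ∀ g, Tendsto (fun i => (v i : K →L[ℂ] K) g) F (𝓝 ((m : K →L[ℂ] K) g)))
    {ψ : M →L[ℂ] ℂ} (hψ : ψ ∈ predual M) : Tendsto (fun i => ψ (v i)) F (𝓝 (ψ m)) := by
  let L : ι → (M →L[ℂ] ℂ) →L[ℂ] ℂ := fun i => ContinuousLinearMap.apply ℂ ℂ (v i - m)
  have hL : ∀ i, ‖L i‖ ≤ C + ‖m‖ := by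
    intro i
    refine ContinuousLinearMap.opNorm_le_bound _
      (add_nonneg ((norm_nonneg _).trans (hv i)) (norm_nonneg _)) fun χ => ?_
    rw [mul_comm]
    exact χ.le_of_opNorm_le_of_le le_rfl ((norm_sub_le _ _).trans (by gcongr; exact hv i))
  have hV : predual M ≤ tendstoZero L F := by
    refine predual_le (isClosed_tendstoZero hL) fun f g => ?_
    rw [mem_tendstoZero]
    change Tendsto (fun i => vectorFunctional M f g (v i - m)) F (𝓝 0)
    simp only [map_sub, vectorFunctional_apply]
    rw [tendsto_sub_nhds_zero_iff]
    exact tendsto_const_nhds.inner (h g)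
  have := mem_tendstoZero.1 (hV hψ)
  change Tendsto (fun i => ψ (v i - m)) F (𝓝 0) at this
  simp only [map_sub] at this
  rwa [tendsto_sub_nhds_zero_iff] at this

theorem comp_mul_left_mem_predual {ψ : M →L[ℂ] ℂ} (hψ : ψ ∈ predual M) (b : M) :
    ψ ∘L (ContinuousLinearMap.mul ℂ M b) ∈ predual M := by
  have hV : predual M ≤ comapPrecomp (ContinuousLinearMap.mul ℂ M b) (predual M) := by
    refine predual_le (isClosed_comapPrecomp _ isClosed_predual) fun f g => ?_
    rw [mem_comapPrecomp]
    have : vectorFunctional M f g ∘L ContinuousLinearMap.mul ℂ M b =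
        vectorFunctional M (ContinuousLinearMap.adjoint (b : K →L[ℂ] K) f) g := by
      ext x
      change ⟪f, (b : K →L[ℂ] K) ((x : K →L[ℂ] K) g)⟫_ℂ = ⟪_, (x : K →L[ℂ] K) g⟫_ℂ
      rw [ContinuousLinearMap.adjoint_inner_left]
    rw [this]
    exact vectorFunctional_mem_predual _ _
  exact mem_comapPrecomp.1 (hV hψ)

theorem nonneg_of_vectorFunctional {x : M} (h : ∀ g : K, 0 ≤ vectorFunctional M g g x) : 0 ≤ x := by
  change (0 : K →L[ℂ] K) ≤ x
  rw [ContinuousLinearMap.nonneg_iff_isPositive, ContinuousLinearMap.isPositive_iff_complex]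
  intro g
  have := h g
  rw [vectorFunctional_apply] at this
  rw [← inner_conj_symm, Complex.conj_eq_iff_im.2 (Complex.le_def.1 this).2.symm]
  exact ⟨Complex.ext rfl (Complex.le_def.1 this).2, (Complex.le_def.1 this).1⟩

theorem vectorFunctional_nonneg {x : M} (hx : 0 ≤ x) (g : K) : 0 ≤ vectorFunctional M g g x := by
  have hx' : (0 : K →L[ℂ] K) ≤ x := hx
  rw [ContinuousLinearMap.nonneg_iff_isPositive] at hx'
  exact hx'.inner_nonneg_right g

end Predual

/-! ### The GNS space -/

section GNS

variable {K : Type u} [NormedAddCommGroup K] [InnerProductSpace ℂ K] [CompleteSpace K]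
variable {M : VonNeumannAlgebra K} (φ : M →ₚ[ℂ] ℂ)

theorem inner_gnsEmbed (x y : M) : ⟪gnsEmbed φ x, gnsEmbed φ y⟫_ℂ = φ (star x * y) := by
  rw [gnsEmbed_eq, gnsEmbed_eq, UniformSpace.Completion.inner_coe, PositiveLinearMap.preGNS_inner_def]
  rfl

theorem denseRange_gnsEmbed : DenseRange (gnsEmbed φ) := by
  have : gnsEmbed φ = (fun x : φ.PreGNS => (x : φ.GNS)) ∘ φ.toPreGNS := funext (gnsEmbed_eq φ)
  rw [this]
  exact UniformSpace.Completion.denseRange_coe.comp φ.toPreGNS.surjective.denseRange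
    (UniformSpace.Completion.continuous_coe _)

theorem norm_gnsEmbed_le (x : M) : ‖gnsEmbed φ x‖ ≤ ‖gnsVector φ‖ * ‖x‖ := by
  rw [mul_comm]
  exact ContinuousLinearMap.le_of_opNorm_le _ (NonUnitalStarAlgHom.norm_apply_le _ x) _

/-- The map `x ↦ π_φ(x) ζ_φ` as a linear map. -/
noncomputable def gnsEmbedₗ : M →ₗ[ℂ] φ.GNS where
  toFun := gnsEmbed φ
  map_add' x y := by rw [gnsEmbed, map_add]; rfl
  map_smul' c x := by rw [gnsEmbed, map_smul]; rfl

/-- The map `x ↦ π_φ(x) ζ_φ` as a bounded linear map. -/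
noncomputable def gnsEmbedL : M →L[ℂ] φ.GNS :=
  (gnsEmbedₗ φ).mkContinuous ‖gnsVector φ‖ (norm_gnsEmbed_le φ)

theorem gnsEmbedL_apply (x : M) : gnsEmbedL φ x = gnsEmbed φ x := rfl

theorem gnsEmbed_mul (x y : M) : gnsEmbed φ (x * y) = φ.gnsStarAlgHom x (gnsEmbed φ y) := by
  rw [gnsEmbed, map_mul]
  rfl

theorem norm_gnsEmbed_sq (x : M) : ((‖gnsEmbed φ x‖ ^ 2 : ℝ) : ℂ) = φ (star x * x) := by
  rw [← inner_gnsEmbed, inner_self_eq_norm_sq_to_K]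
  norm_cast

/-- The functional `x ↦ ⟪f, x ζ_φ⟫`. -/
noncomputable def gnsFunctional (f : φ.GNS) : M →L[ℂ] ℂ := innerSL ℂ f ∘L gnsEmbedL φ

theorem gnsFunctional_apply (f : φ.GNS) (x : M) : gnsFunctional φ f x = ⟪f, gnsEmbed φ x⟫_ℂ := rfl

theorem continuous_gnsFunctional : Continuous (gnsFunctional φ) := by
  unfold gnsFunctional
  fun_prop

theorem gnsFunctional_sub (f g : φ.GNS) :
    gnsFunctional φ (f - g) = gnsFunctional φ f - gnsFunctional φ g := by
  ext x
  exact inner_sub_left (𝕜 := ℂ) f g (gnsEmbed φ x)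

variable {φ} (hφ : IsFaithfulNormalState φ)
include hφ

theorem gnsEmbed_injective : Function.Injective (gnsEmbed φ) := by
  refine (injective_iff_map_eq_zero (gnsEmbedL φ)).2 fun x hx => ?_
  have h := norm_gnsEmbed_sq φ x
  rw [← gnsEmbedL_apply, hx, norm_zero] at h
  have h1 := hφ.faithful (star x * x) (star_mul_self_nonneg x) (by rw [← h]; simp)
  exact CStarRing.star_mul_self_eq_zero_iff x |>.1 h1

theorem gnsFunctional_mem_predual (f : φ.GNS) : gnsFunctional φ f ∈ predual M := by
  induction f using (denseRange_gnsEmbed φ).induction_on with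
  | hp => exact isClosed_predual.preimage (continuous_gnsFunctional φ)
  | ih a =>
    have : gnsFunctional φ (gnsEmbed φ a) =
        toCLM φ ∘L ContinuousLinearMap.mul ℂ M (star a) := by
      ext x
      exact inner_gnsEmbed φ a x
    rw [this]
    exact comp_mul_left_mem_predual hφ.normal _

/-- The functionals `x ↦ ⟪f, x ζ_φ⟫` are dense in the predual. -/
theorem predual_le_of_gnsFunctional_mem {V : Submodule ℂ (M →L[ℂ] ℂ)}
    (hV : IsClosed (V : Set (M →L[ℂ] ℂ))) (h : ∀ f, gnsFunctional φ f ∈ V) : predual M ≤ V := by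
  intro ψ hψ
  by_contra hcon
  obtain ⟨F, hFV, hF⟩ := exists_dual_eq_zero_of_notMem hV hcon
  obtain ⟨y, hy⟩ := exists_eq_apply F
  -- Testing the annihilating element `y` against `f = yζ` gives `‖yζ‖² = 0`, so `y = 0` by
  -- faithfulness.
  have h1 := hFV _ (h (gnsEmbed φ y))
  rw [hy _ (gnsFunctional_mem_predual hφ _), gnsFunctional_apply, inner_self_eq_zero] at h1
  have h2 : y = 0 := gnsEmbed_injective hφ (h1.trans (map_zero (gnsEmbedL φ)).symm)
  rw [hy ψ hψ, h2, map_zero] at hF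
  exact hF rfl

end GNS


variable {K : Type u} [NormedAddCommGroup K] [InnerProductSpace ℂ K] [CompleteSpace K]
variable {M : VonNeumannAlgebra K} {φ : M →ₚ[ℂ] ℂ}

/-! ### Maps implemented on the GNS space, and the averages -/

/-- Split `x` into four positive parts of norm at most `‖x‖`. The constant 4 is not sharp; only its
uniformity in `σ` matters. -/
theorem norm_apply_le_of_map_one_le {σ : M →ₚ[ℂ] M} (hσ : σ 1 ≤ 1) (x : M) :
    ‖σ x‖ ≤ 4 * ‖x‖ := by
  have h1 : ‖σ 1‖ ≤ 1 := (CStarAlgebra.norm_le_one_iff_of_nonneg (σ 1)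
    (σ.map_nonneg zero_le_one)).2 hσ
  obtain ⟨y, hy0, hyn, hy⟩ := CStarAlgebra.exists_sum_four_nonneg x
  have h2 : ∀ i, ‖σ (y i)‖ ≤ ‖x‖ := fun i =>
    (σ.norm_apply_le_of_nonneg _ (hy0 i)).trans
      ((mul_le_of_le_one_left (norm_nonneg _) h1).trans (hyn i))
  conv_lhs => rw [hy, map_sum]
  refine (norm_sum_le_of_le _ (n := fun _ => ‖x‖) fun i _ => ?_).trans (by simp)
  rw [map_smul, norm_smul, norm_pow, Complex.norm_I, one_pow, one_mul]
  exact h2 i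

theorem norm_toCLM_le_of_map_one_le {σ : M →ₚ[ℂ] M} (hσ : σ 1 ≤ 1) : ‖toCLM σ‖ ≤ 4 :=
  ContinuousLinearMap.opNorm_le_bound _ (by norm_num) (norm_apply_le_of_map_one_le hσ)

theorem map_star_mul_map_eq (σ : M →ₚ[ℂ] M) (x : M) :
    φ (σ (star x) * σ x) = ((‖gnsEmbed φ (σ x)‖ ^ 2 : ℝ) : ℂ) := by
  rw [map_star, norm_gnsEmbed_sq]

theorem map_star_mul_map_le_iff (σ : M →ₚ[ℂ] M) (x : M) :
    φ (σ (star x) * σ x) ≤ φ (star x * x) ↔ ‖gnsEmbed φ (σ x)‖ ≤ ‖gnsEmbed φ x‖ := by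
  rw [map_star_mul_map_eq, ← norm_gnsEmbed_sq, Complex.real_le_real,
    sq_le_sq₀ (norm_nonneg _) (norm_nonneg _)]

/-- This turns questions about the predual into questions about vectors: precomposition with `σ`
becomes the adjoint of its implementing operator. -/
theorem gnsFunctional_comp {σ : M →ₚ[ℂ] M} {A : φ.GNS →L[ℂ] φ.GNS}
    (hA : ∀ x, gnsEmbed φ (σ x) = A (gnsEmbed φ x)) (f : φ.GNS) :
    (gnsFunctional φ f).comp (toCLM σ) =
      gnsFunctional φ (ContinuousLinearMap.adjoint A f) := by
  ext x
  change ⟪f, gnsEmbed φ (σ x)⟫_ℂ = ⟪_, gnsEmbed φ x⟫_ℂ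
  rw [hA, ContinuousLinearMap.adjoint_inner_left]

/-- A positive map implemented by a bounded operator of the GNS space is normal. -/
theorem comp_mem_predual (hφ : IsFaithfulNormalState φ) {σ : M →ₚ[ℂ] M} {A : φ.GNS →L[ℂ] φ.GNS}
    (hA : ∀ x, gnsEmbed φ (σ x) = A (gnsEmbed φ x)) {ψ : M →L[ℂ] ℂ} (hψ : ψ ∈ predual M) :
    ψ.comp (toCLM σ) ∈ predual M := by
  have hV : predual M ≤ comapPrecomp (toCLM σ) (predual M) :=
    predual_le_of_gnsFunctional_mem hφ (isClosed_comapPrecomp _ isClosed_predual) fun f => by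
      rw [mem_comapPrecomp, gnsFunctional_comp hA]
      exact gnsFunctional_mem_predual hφ _
  exact mem_comapPrecomp.1 (hV hψ)

theorem cesaro_apply (τ : M →ₚ[ℂ] M) (n : ℕ) (x : M) :
    cesaro τ n x = (n : ℂ)⁻¹ • ∑ k ∈ Finset.range n, (τ.toLinearMap ^ k) x := by
  rw [← LinearMap.sum_apply]
  rfl

theorem cesaro_apply_real (τ : M →ₚ[ℂ] M) (n : ℕ) (x : M) :
    cesaro τ n x = ((n : ℝ)⁻¹ : ℝ) • ∑ k ∈ Finset.range n, (τ.toLinearMap ^ k) x := by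
  rw [cesaro_apply, ← Complex.coe_smul, Complex.ofReal_inv, Complex.ofReal_natCast]

theorem mem_tendstoPrecomp_toCLM {σ : ℕ → M →ₚ[ℂ] M} {σ' : M →ₚ[ℂ] M} {ψ : M →L[ℂ] ℂ} :
    ψ ∈ tendstoPrecomp (fun n => toCLM (σ n)) (toCLM σ') atTop ↔
      Tendsto (fun n => ‖ψ.comp (toCLM (σ n)) - ψ.comp (toCLM σ')‖) atTop (𝓝 0) :=
  mem_tendstoPrecomp

/-- Norm convergence on the predual can be checked on the functionals `x ↦ ⟪f, x ζ_φ⟫`. -/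
theorem tendsto_norm_comp_sub_of_gnsFunctional (hφ : IsFaithfulNormalState φ)
    {σ : ℕ → M →ₚ[ℂ] M} {σ' : M →ₚ[ℂ] M} (hσ : ∀ n, σ n 1 ≤ 1) (hσ' : σ' 1 ≤ 1)
    (h : ∀ f, Tendsto (fun n => ‖(gnsFunctional φ f).comp (toCLM (σ n)) -
      (gnsFunctional φ f).comp (toCLM σ')‖) atTop (𝓝 0))
    {ψ : M →L[ℂ] ℂ} (hψ : ψ ∈ predual M) :
    Tendsto (fun n => ‖ψ.comp (toCLM (σ n)) - ψ.comp (toCLM σ')‖) atTop (𝓝 0) := by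
  have hV : predual M ≤ tendstoPrecomp (fun n => toCLM (σ n)) (toCLM σ') atTop :=
    predual_le_of_gnsFunctional_mem hφ (isClosed_tendstoPrecomp
      (fun n => norm_toCLM_le_of_map_one_le (hσ n)) (norm_toCLM_le_of_map_one_le hσ'))
      fun f => mem_tendstoPrecomp_toCLM.2 (h f)
  exact mem_tendstoPrecomp_toCLM.1 (hV hψ)

section Contraction

variable {τ : M →ₚ[ℂ] M} (hτ : τ ∈ PHalf φ)
include hτ

theorem norm_gnsContraction_le : ‖gnsContraction hτ‖ ≤ 1 := by
  refine ContinuousLinearMap.opNorm_le_bound _ zero_le_one fun f => ?_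
  rw [one_mul]
  induction f using (denseRange_gnsEmbed φ).induction_on with
  | hp => exact isClosed_le (gnsContraction hτ).continuous.norm continuous_norm
  | ih a =>
    rw [gnsContraction_gnsEmbed]
    exact (map_star_mul_map_le_iff τ a).1 (hτ.2.2 a)

theorem gnsEmbed_cesaro (n : ℕ) (x : M) :
    gnsEmbed φ (cesaro τ n x) = average (gnsContraction hτ) n (gnsEmbed φ x) := by
  have hpow : ∀ k, gnsEmbed φ ((τ.toLinearMap ^ k) x) = (gnsContraction hτ ^ k) (gnsEmbed φ x) := by
    intro k
    induction k with
    | zero => rfl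
    | succ k ih =>
      rw [pow_succ', pow_succ']
      change gnsEmbed φ (τ ((τ.toLinearMap ^ k) x)) =
        gnsContraction hτ ((gnsContraction hτ ^ k) (gnsEmbed φ x))
      rw [← ih, gnsContraction_gnsEmbed]
  rw [cesaro_apply, ← gnsEmbedL_apply, map_smul, map_sum, average, smul_apply, sum_apply]
  congr 1
  exact Finset.sum_congr rfl fun k _ => hpow k

theorem pow_one_le (k : ℕ) : (τ.toLinearMap ^ k) 1 ≤ 1 := by
  induction k with
  | zero => exact le_rfl
  | succ k ih =>
    rw [pow_succ']
    exact (OrderHomClass.mono τ ih).trans hτ.2.1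

theorem pow_nonneg_apply (k : ℕ) {x : M} (hx : 0 ≤ x) :
    0 ≤ (τ.toLinearMap ^ k) x ∧ φ ((τ.toLinearMap ^ k) x) ≤ φ x := by
  induction k with
  | zero => exact ⟨hx, le_rfl⟩
  | succ k ih =>
    rw [pow_succ']
    exact ⟨τ.map_nonneg ih.1, (hτ.1 _ ih.1).trans ih.2⟩

theorem cesaro_one_le (n : ℕ) : cesaro τ n 1 ≤ 1 := by
  rw [cesaro_apply_real]
  rcases eq_or_ne n 0 with rfl | hn
  · simp
  · have h : ∑ k ∈ Finset.range n, (τ.toLinearMap ^ k) (1 : M) ≤ (n : ℝ) • (1 : M) := by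
      refine (Finset.sum_le_sum fun k _ => pow_one_le hτ k).trans ?_
      rw [Finset.sum_const, Finset.card_range, Nat.cast_smul_eq_nsmul]
    refine (smul_le_smul_of_nonneg_left h (by positivity)).trans ?_
    rw [smul_smul, inv_mul_cancel₀ (by exact_mod_cast hn), one_smul]

theorem state_cesaro_le (n : ℕ) {x : M} (hx : 0 ≤ x) : φ (cesaro τ n x) ≤ φ x := by
  rw [cesaro_apply_real, ← Complex.coe_smul, map_smul, Complex.coe_smul, map_sum]
  rcases eq_or_ne n 0 with rfl | hn
  · simpa using φ.map_nonneg hx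
  · have h : ∑ k ∈ Finset.range n, φ ((τ.toLinearMap ^ k) x) ≤ (n : ℝ) • φ x := by
      refine (Finset.sum_le_sum fun k _ => (pow_nonneg_apply hτ k hx).2).trans ?_
      rw [Finset.sum_const, Finset.card_range, Nat.cast_smul_eq_nsmul]
    refine (smul_le_smul_of_nonneg_left h (by positivity)).trans ?_
    rw [smul_smul, inv_mul_cancel₀ (by exact_mod_cast hn), one_smul]

theorem cesaro_mem_PHalf (n : ℕ) : cesaro τ n ∈ PHalf φ := by
  refine ⟨fun x hx => state_cesaro_le hτ n hx, cesaro_one_le hτ n, fun x => ?_⟩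
  rw [map_star_mul_map_le_iff, gnsEmbed_cesaro hτ]
  exact ((average _ n).le_of_opNorm_le (norm_average_le (norm_gnsContraction_le hτ) n) _).trans
    (one_mul _).le

/-! ### The limit map -/

variable (hφ : IsFaithfulNormalState φ)
include hφ

/-- The `σ`-weak limit of the averages. -/
theorem exists_limit_map : ∃ E ∈ PHalf φ, ∀ x,
    gnsEmbed φ (E x) =
      (invariantVectors (gnsContraction hτ)).starProjection (gnsEmbed φ x) := by
  -- The ultrafilter only supplies a limit inside `M`; the identity with the projection `P` shows
  -- afterwards that the choice is immaterial.
  let U : Ultrafilter ℕ := hyperfilter ℕ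
  have hU : (U : Filter ℕ) ≤ atTop := Nat.hyperfilter_le_atTop
  have hex : ∀ x : M, ∃ y : M, ∀ ψ ∈ predual M,
      Tendsto (fun n => ψ (cesaro τ n x)) U (𝓝 (ψ y)) := fun x =>
    exists_tendsto_ultrafilter U fun n => norm_apply_le_of_map_one_le (cesaro_one_le hτ n) x
  choose e he using hex
  let e' : M →ₗ[ℂ] M :=
    { toFun := e
      map_add' := fun x y => eq_of_predual fun ψ hψ => by
        refine tendsto_nhds_unique (he (x + y) ψ hψ) ?_
        simp only [map_add]
        exact (he x ψ hψ).add (he y ψ hψ)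
      map_smul' := fun c x => eq_of_predual fun ψ hψ => by
        refine tendsto_nhds_unique (he (c • x) ψ hψ) ?_
        simp only [map_smul]
        exact (he x ψ hψ).const_smul c }
  let E : M →ₚ[ℂ] M := PositiveLinearMap.mk₀ e' fun x hx =>
    nonneg_of_vectorFunctional fun g =>
      ge_of_tendsto' (he x _ (vectorFunctional_mem_predual g g)) fun n =>
        vectorFunctional_nonneg ((cesaro τ n).map_nonneg hx) g
  have hE : ∀ x, ∀ ψ ∈ predual M, Tendsto (fun n => ψ (cesaro τ n x)) U (𝓝 (ψ (E x))) := he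
  have hP : ∀ x, gnsEmbed φ (E x) =
      (invariantVectors (gnsContraction hτ)).starProjection (gnsEmbed φ x) := by
    intro x
    refine ext_inner_left ℂ fun f => ?_
    refine tendsto_nhds_unique (hE x _ (gnsFunctional_mem_predual hφ f)) ?_
    simp only [gnsFunctional_apply, gnsEmbed_cesaro hτ]
    exact (tendsto_const_nhds.inner
      (tendsto_average (norm_gnsContraction_le hτ) (gnsEmbed φ x))).mono_left hU
  refine ⟨E, ⟨fun x hx => ?_, ?_, fun x => ?_⟩, hP⟩
  · exact le_of_tendsto' (hE x _ hφ.normal) fun n => state_cesaro_le hτ n hx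
  · rw [← sub_nonneg]
    refine nonneg_of_vectorFunctional fun g => ?_
    rw [map_sub]
    refine ge_of_tendsto' (tendsto_const_nhds.sub (hE 1 _ (vectorFunctional_mem_predual g g)))
      fun n => ?_
    rw [← map_sub]
    exact vectorFunctional_nonneg (sub_nonneg.2 (cesaro_one_le hτ n)) g
  · rw [map_star_mul_map_le_iff, hP]
    exact Submodule.norm_starProjection_apply_le _ _

variable {E : M →ₚ[ℂ] M} (hE : E ∈ PHalf φ) (hP : ∀ x, gnsEmbed φ (E x) =
    (invariantVectors (gnsContraction hτ)).starProjection (gnsEmbed φ x))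

omit hφ in
theorem gnsEmbed_mem_invariantVectors {x : M} (hx : x ∈ fixedPoints τ) :
    gnsEmbed φ x ∈ invariantVectors (gnsContraction hτ) := by
  rw [mem_invariantVectors, gnsContraction_gnsEmbed, hx]

include hP

theorem range_limit_map : Set.range E = fixedPoints τ := by
  ext y
  constructor
  · rintro ⟨x, rfl⟩
    refine gnsEmbed_injective hφ ?_
    rw [← gnsContraction_gnsEmbed hτ, ← mem_invariantVectors, hP]
    exact Submodule.starProjection_apply_mem _ _
  · intro hy
    refine ⟨y, gnsEmbed_injective hφ ?_⟩
    rw [hP, Submodule.starProjection_eq_self_iff]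
    exact gnsEmbed_mem_invariantVectors hτ hy

theorem limit_map_apply_eq_self_iff {x : M} : E x = x ↔ x ∈ fixedPoints τ := by
  constructor
  · intro h
    rw [← range_limit_map hτ hφ hP]
    exact ⟨x, h⟩
  · intro hx
    refine gnsEmbed_injective hφ ?_
    rw [hP, Submodule.starProjection_eq_self_iff]
    exact gnsEmbed_mem_invariantVectors hτ hx

/-- The vectors `xζ` are dense, so their images `P(xζ) = E(x)ζ` are dense in the range of `P`. -/
theorem invariantVectors_eq_closure : invariantVectors (gnsContraction hτ) =
    (Submodule.span ℂ (gnsEmbed φ '' fixedPoints τ)).topologicalClosure := by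
  refine le_antisymm (fun f hf => ?_) ?_
  · rw [← Submodule.starProjection_eq_self_iff.2 hf]
    refine map_mem_closure
      (ContinuousLinearMap.continuous (invariantVectors (gnsContraction hτ)).starProjection)
      (denseRange_gnsEmbed φ f) ?_
    rintro _ ⟨x, rfl⟩
    rw [← hP]
    refine Submodule.subset_span ⟨E x, ?_, rfl⟩
    rw [← range_limit_map hτ hφ hP]
    exact ⟨x, rfl⟩
  · refine Submodule.topologicalClosure_minimal _ (Submodule.span_le.2 ?_)
      (isClosed_invariantVectors _)
    rintro _ ⟨x, hx, rfl⟩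
    exact gnsEmbed_mem_invariantVectors hτ hx

include hE in
theorem tendsto_norm_comp_cesaro_sub {ψ : M →L[ℂ] ℂ} (hψ : ψ ∈ predual M) :
    Tendsto (fun n => ‖ψ.comp (toCLM (cesaro τ n)) - ψ.comp (toCLM E)‖) atTop (𝓝 0) := by
  refine tendsto_norm_comp_sub_of_gnsFunctional hφ (cesaro_one_le hτ) hE.2.1 (fun f => ?_) hψ
  have h1 : ∀ n, (gnsFunctional φ f).comp (toCLM (cesaro τ n)) -
      (gnsFunctional φ f).comp (toCLM E) =
      gnsFunctional φ (average (ContinuousLinearMap.adjoint (gnsContraction hτ)) n f -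
        (invariantVectors (gnsContraction hτ)).starProjection f) := by
    intro n
    rw [gnsFunctional_sub, ← adjoint_average, gnsFunctional_comp (gnsEmbed_cesaro hτ n),
      gnsFunctional_comp hP, adjoint_starProjection]
  have h2 : Tendsto (fun n => average (ContinuousLinearMap.adjoint (gnsContraction hτ)) n f -
      (invariantVectors (gnsContraction hτ)).starProjection f) atTop (𝓝 0) := by
    have hT := norm_gnsContraction_le hτ
    rw [tendsto_sub_nhds_zero_iff]
    have h3 := tendsto_average (T := ContinuousLinearMap.adjoint (gnsContraction hτ))
      (by rwa [LinearIsometryEquiv.norm_map]) f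
    simp only [invariantVectors_adjoint hT] at h3
    exact h3
  have h4 := ((continuous_gnsFunctional φ).norm.tendsto 0).comp h2
  have h5 : gnsFunctional φ 0 = 0 := by
    have := gnsFunctional_sub φ 0 0
    rwa [sub_self, sub_self] at this
  rw [h5, norm_zero] at h4
  simp only [h1]
  exact h4

/-! ### The fixed-point algebra -/

theorem bimodule_of_isVonNeumannSubalgebra (h : IsVonNeumannSubalgebra (fixedPoints τ)) :
    E 1 = 1 ∧ ∀ y ∈ fixedPoints τ, ∀ z ∈ fixedPoints τ, ∀ x : M, y * E x * z = E (y * x * z) := by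
  obtain ⟨S, hS⟩ := h
  have hmem : ∀ x : M, x ∈ fixedPoints τ ↔ (x : K →L[ℂ] K) ∈ S := fun x => by
    rw [← SetLike.mem_coe, hS, Subtype.val_injective.mem_set_image]
  have hstar : ∀ x : M, x ∈ fixedPoints τ → star x ∈ fixedPoints τ := fun x hx =>
    (hmem _).2 (star_mem ((hmem x).1 hx))
  have hmul : ∀ x y : M, x ∈ fixedPoints τ → y ∈ fixedPoints τ → x * y ∈ fixedPoints τ :=
    fun x y hx hy => (hmem _).2 (mul_mem ((hmem x).1 hx) ((hmem y).1 hy))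
  have hinv : ∀ y ∈ fixedPoints τ, ∀ f ∈ invariantVectors (gnsContraction hτ),
      φ.gnsStarAlgHom y f ∈ invariantVectors (gnsContraction hτ) := by
    intro y hy
    refine mapsTo_invariantVectors (invariantVectors_eq_closure hτ hφ hP) ?_
    rintro _ ⟨x, hx, rfl⟩
    rw [← gnsEmbed_mul]
    exact gnsEmbed_mem_invariantVectors hτ (hmul y x hy hx)
  have hleft : ∀ y ∈ fixedPoints τ, ∀ x, E (y * x) = y * E x := by
    intro y hy x
    refine gnsEmbed_injective hφ ?_
    rw [hP, gnsEmbed_mul, gnsEmbed_mul, hP]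
    refine starProjection_apply_of_mapsTo _ _ (hinv y hy) ?_ _
    rw [← ContinuousLinearMap.star_eq_adjoint, ← map_star]
    exact hinv _ (hstar y hy)
  -- The right module property is the left one conjugated by the star.
  have hright : ∀ z ∈ fixedPoints τ, ∀ x, E (x * z) = E x * z := by
    intro z hz x
    have h1 := congrArg star (hleft (star z) (hstar z hz) (star x))
    rwa [← star_mul, map_star, star_star, star_mul, map_star, star_star, star_star] at h1
  refine ⟨(limit_map_apply_eq_self_iff hτ hφ hP).2 ((hmem 1).2 (one_mem S)),
    fun y hy z hz x => ?_⟩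
  rw [hright z hz, hleft y hy]

theorem isVonNeumannSubalgebra_of_bimodule (h1 : E 1 = 1)
    (hbi : ∀ y ∈ fixedPoints τ, ∀ z ∈ fixedPoints τ, ∀ x : M, y * E x * z = E (y * x * z)) :
    IsVonNeumannSubalgebra (fixedPoints τ) := by
  have hfix : ∀ {x : M}, E x = x ↔ x ∈ fixedPoints τ := limit_map_apply_eq_self_iff hτ hφ hP
  let S : StarSubalgebra ℂ (K →L[ℂ] K) :=
    { carrier := Subtype.val '' fixedPoints τ
      mul_mem' := by
        rintro _ _ ⟨y, hy, rfl⟩ ⟨z, hz, rfl⟩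
        refine ⟨y * z, hfix.1 ?_, rfl⟩
        -- Taking the middle element to be `1` gives `y z = E(y z)`.
        have := hbi y hy z hz 1
        rwa [h1, mul_one, eq_comm] at this
      add_mem' := by
        rintro _ _ ⟨y, hy, rfl⟩ ⟨z, hz, rfl⟩
        exact ⟨y + z, (map_add τ y z).trans (congrArg₂ _ hy hz), rfl⟩
      algebraMap_mem' := fun c => by
        refine ⟨c • 1, hfix.1 (by rw [map_smul, h1]), ?_⟩
        rw [Algebra.algebraMap_eq_smul_one]
        rfl
      star_mem' := by
        rintro _ ⟨y, hy, rfl⟩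
        exact ⟨star y, (map_star τ y).trans (congrArg star hy), rfl⟩ }
  have hSM : ∀ {y}, y ∈ S → y ∈ M := by
    rintro _ ⟨y, -, rfl⟩
    exact y.2
  have hS : IsClosed (S : Set (K →L[ℂ] K)) :=
    (instIsClosedVN M).isClosedEmbedding_subtypeVal.isClosedMap _
      (isClosed_eq (map_continuous τ) continuous_id)
  -- Self-adjoint elements suffice, since `S''` is closed under real and imaginary parts.
  have hsa : ∀ x ∈ Set.centralizer (Set.centralizer (S : Set (K →L[ℂ] K))), IsSelfAdjoint x →
      x ∈ S := by
    intro x hx hxs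
    have := strongNhds_neBot S hx hxs
    have hxM : x ∈ M := by
      rw [← SetLike.mem_coe, ← M.centralizer_centralizer]
      exact Set.centralizer_subset (Set.centralizer_subset fun y hy => hSM hy) hx
    have hMc : IsClosed (M.toStarSubalgebra : Set (K →L[ℂ] K)) := instIsClosedVN M
    have hrM : resolventI x ∈ M := (resolventI_mem_iff hMc hxs).2 hxM
    let v : {y : K →L[ℂ] K // y ∈ S ∧ IsSelfAdjoint y} → M := fun y =>
      ⟨resolventI y.1, hSM ((resolventI_mem_iff hS y.2.2).2 y.2.1)⟩
    have hv : ∀ y, E (v y) = v y := by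
      intro y
      obtain ⟨w, hw, hwv⟩ := (resolventI_mem_iff hS y.2.2).2 y.2.1
      rw [hfix, ← show w = v y from Subtype.ext hwv]
      exact hw
    have hvn : ∀ y, ‖v y‖ ≤ 1 := fun y => norm_resolventI_le y.2.2
    have hvt : ∀ g, Tendsto (fun y => (v y : K →L[ℂ] K) g) (strongNhds S x)
        (𝓝 (resolventI x g)) := tendsto_resolventI S hxs
    have hlim : ∀ ψ ∈ predual M,
        Tendsto (fun y => ψ (v y)) (strongNhds S x) (𝓝 (ψ ⟨resolventI x, hrM⟩)) := fun ψ hψ =>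
      tendsto_predual_of_strong (m := ⟨resolventI x, hrM⟩) hvn hvt hψ
    -- Both `ψ` and `ψ ∘ E` lie in the predual and agree on the fixed resolvents of `y`, so they
    -- have the same limit.
    have hr : E ⟨resolventI x, hrM⟩ = ⟨resolventI x, hrM⟩ := eq_of_predual fun ψ hψ => by
      refine tendsto_nhds_unique (hlim _ (comp_mem_predual hφ hP hψ)) ?_
      refine (hlim ψ hψ).congr fun y => ?_
      exact (congrArg ψ (hv y)).symm
    exact (resolventI_mem_iff hS hxs).1 ⟨_, hfix.1 hr, rfl⟩
  refine ⟨⟨S, (Set.Subset.antisymm ?_ Set.subset_centralizer_centralizer)⟩, rfl⟩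
  intro x hx
  have hstar : star x ∈ Set.centralizer (Set.centralizer (S : Set (K →L[ℂ] K))) := by
    refine Set.star_mem_centralizer' (fun z hz => Set.star_mem_centralizer' (fun y hy => ?_) hz) hx
    exact star_mem (s := S) hy
  have hre : (realPart x : K →L[ℂ] K) ∈ S := by
    refine hsa _ ?_ (realPart x).2
    rw [realPart_apply_coe, ← Complex.coe_smul]
    exact Set.smul_mem_centralizer _ (Set.add_mem_centralizer hx hstar)
  have him : (imaginaryPart x : K →L[ℂ] K) ∈ S := by
    refine hsa _ ?_ (imaginaryPart x).2
    rw [imaginaryPart_apply_coe, ← Complex.coe_smul, sub_eq_add_neg]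
    exact Set.smul_mem_centralizer _ (Set.smul_mem_centralizer _
      (Set.add_mem_centralizer hx (Set.neg_mem_centralizer hstar)))
  rw [← realPart_add_I_smul_imaginaryPart x]
  exact S.add_mem hre (S.smul_mem him _)

end Contraction

end VNErgodic

theorem theorem2p3 {K : Type*} [NormedAddCommGroup K] [InnerProductSpace ℂ K] [CompleteSpace K]
    (M : VonNeumannAlgebra K) (φ : M →ₚ[ℂ] ℂ) (hφ : VNErgodic.IsFaithfulNormalState φ)
    (τ : M →ₚ[ℂ] M) (hτ : τ ∈ VNErgodic.PHalf φ) :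
    (∀ n : ℕ, 1 ≤ n → VNErgodic.cesaro τ n ∈ VNErgodic.PHalf φ) ∧
    ∃ E : M →ₚ[ℂ] M,
      E ∈ VNErgodic.PHalf φ ∧
      Set.range E = VNErgodic.fixedPoints τ ∧
      -- convergence in the norm of the predual
      (∀ ψ ∈ VNErgodic.predual M,
        (∀ n : ℕ, 1 ≤ n →
          ψ.comp (VNErgodic.toCLM (VNErgodic.cesaro τ n)) ∈ VNErgodic.predual M) ∧
        ψ.comp (VNErgodic.toCLM E) ∈ VNErgodic.predual M ∧
        Tendsto
          (fun n : ℕ => ‖ψ.comp (VNErgodic.toCLM (VNErgodic.cesaro τ n)) - ψ.comp (VNErgodic.toCLM E)‖)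
          atTop (𝓝 0)) ∧
      -- (a)
      (∀ x : M,
        (VNErgodic.invariantVectors (VNErgodic.gnsContraction hτ)).starProjection
          (VNErgodic.gnsEmbed φ x) = VNErgodic.gnsEmbed φ (E x)) ∧
      VNErgodic.invariantVectors (VNErgodic.gnsContraction hτ) =
        (Submodule.span ℂ
          (VNErgodic.gnsEmbed φ '' VNErgodic.fixedPoints τ)).topologicalClosure ∧
      -- (b)
      (VNErgodic.IsVonNeumannSubalgebra (VNErgodic.fixedPoints τ) ↔
        (E 1 = 1 ∧ ∀ y ∈ VNErgodic.fixedPoints τ, ∀ z ∈ VNErgodic.fixedPoints τ, ∀ x : M,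
          y * E x * z = E (y * x * z))) ∧
      (E 1 = 1 ↔ τ 1 = 1) := by
  obtain ⟨E, hE, hP⟩ := VNErgodic.exists_limit_map hτ hφ
  exact ⟨fun n _ => VNErgodic.cesaro_mem_PHalf hτ n, E, hE, VNErgodic.range_limit_map hτ hφ hP,
    fun ψ hψ => ⟨fun n _ => VNErgodic.comp_mem_predual hφ (VNErgodic.gnsEmbed_cesaro hτ n) hψ,
      VNErgodic.comp_mem_predual hφ hP hψ,
      VNErgodic.tendsto_norm_comp_cesaro_sub hτ hφ hE hP hψ⟩,
    fun x => (hP x).symm, VNErgodic.invariantVectors_eq_closure hτ hφ hP,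
    ⟨VNErgodic.bimodule_of_isVonNeumannSubalgebra hτ hφ hP,
      fun h => VNErgodic.isVonNeumannSubalgebra_of_bimodule hτ hφ hP h.1 h.2⟩,
    VNErgodic.limit_map_apply_eq_self_iff hτ hφ hP⟩
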